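/- Let $k\in\{-1,0,1\}$, let $D\subseteq\mathbb R$ be open, let $a:D\to(0,\infty)$ be of class $C^2$, and consider the FRW metric $$ds^2=-dt^2+a(t)^2\Big\{\frac{dr^2}{1-kr^2}+r^2\,[d\theta^2+\sin^2\theta\,d\phi^2]\Big\}$$ on the coordinate domain $t\in D$, $r>0$, $1-kr^2>0$, $0<\theta<\pi$, $0<\phi<2\pi$. Let $e_{\hat t}=\partial_t$, $e_{\hat r}=\frac{\sqrt{1-kr^2}}{a}\partial_r$, $e_{\hat\theta}=\frac1{ar}\partial_\theta$, $e_{\hat\phi}=\frac1{ar\sin\theta}\partial_\phi$. Then: 1. this frame is orthonormal, the Weyl tensor vanishes identically, and in this frame the Ricci tensor is diagonal with $R_{\hat r\hat r}=R_{\hat\theta\hat\theta}=R_{\hat\phi\hat\phi}$, so that it has at most two independent components; 2. with $G_{ab}=R_{ab}-\frac12Rg_{ab}$, $$R_{\hat t\hat t}=-3\,\frac{\ddot a}{a},\qquad G_{\hat t\hat t}=3\Big(\frac{\dot a^2}{a^2}+\frac{k}{a^2}\Big);$$ 3. call a polynomial curvature invariant any polynomial, with constant real coefficients, in the scalars obtained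 by contracting completely, with the inverse metric, products of copies of the Riemann tensor $R_{abcd}$ and of the volume form $\varepsilon_{abcd}=\sqrt{|\det g|}\,[abcd]$ (no derivatives of the curvature). Consider any way of letting the time $t$ vary in $D$, for example $t\to t_\odot$ within $D$ for a finite time $t_\odot\in\overline D$ or $t\to\pm\infty$ within $D$ (formally: any proper filter on $\mathbb R$ that contains $D$); the point $(r,\theta,\phi)$ is unrestricted. Then every polynomial curvature invariant stays finite if and only if both $R_{\hat t\hat t}$ and $G_{\hat t\hat t}$ stay finite. This holds both when "stays finite" means "is eventually bounded" and when it means "converges to a finite limit". -/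

import Mathlib

open Filter Topology

namespace FRW

/-! ### Curvature of a metric on a four-dimensional coordinate domain -/

/-- Points of a four-dimensional coordinate domain. -/
abbrev Coord : Type := Fin 4 → ℝ

/-- The partial derivative of `f` in the `i`-th coordinate direction at `x`. -/
noncomputable def partialDeriv (i : Fin 4) (f : Coord → ℝ) (x : Coord) : ℝ :=
  deriv (fun s : ℝ => f (Function.update x i s)) (x i)

/-- The Christoffel symbols `Γ^i_{jk}` of the Levi-Civita connection of the metric `g`. -/
noncomputable def christoffel (g : Coord → Matrix (Fin 4) (Fin 4) ℝ) (i j k : Fin 4)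
    (x : Coord) : ℝ :=
  (1 / 2) * ∑ l, (g x)⁻¹ i l *
    (partialDeriv j (fun y => g y l k) x + partialDeriv k (fun y => g y l j) x
      - partialDeriv l (fun y => g y j k) x)

/-- The curvature tensor
`R^i_{jkl} = ∂_k Γ^i_{lj} - ∂_l Γ^i_{kj} + Γ^i_{km} Γ^m_{lj} - Γ^i_{lm} Γ^m_{kj}`. -/
noncomputable def riemannUp (g : Coord → Matrix (Fin 4) (Fin 4) ℝ) (i j k l : Fin 4)
    (x : Coord) : ℝ :=
  partialDeriv k (christoffel g i l j) x - partialDeriv l (christoffel g i k j) x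
    + ∑ m, (christoffel g i k m x * christoffel g m l j x
      - christoffel g i l m x * christoffel g m k j x)

/-- The covariant curvature tensor `R_{ijkl} = g_{im} R^m_{jkl}`. -/
noncomputable def riemann (g : Coord → Matrix (Fin 4) (Fin 4) ℝ) (i j k l : Fin 4)
    (x : Coord) : ℝ :=
  ∑ m, g x i m * riemannUp g m j k l x

/-- The Ricci tensor `R_{jl} = R^i_{jil}`. -/
noncomputable def ricci (g : Coord → Matrix (Fin 4) (Fin 4) ℝ) (j l : Fin 4) (x : Coord) : ℝ :=
  ∑ i, riemannUp g i j i l x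

/-- The Ricci scalar `R = g^{jl} R_{jl}`. -/
noncomputable def ricciScalar (g : Coord → Matrix (Fin 4) (Fin 4) ℝ) (x : Coord) : ℝ :=
  ∑ j, ∑ l, (g x)⁻¹ j l * ricci g j l x

/-- The Einstein tensor `G_{jl} = R_{jl} - (1/2) R g_{jl}`. -/
noncomputable def einstein (g : Coord → Matrix (Fin 4) (Fin 4) ℝ) (j l : Fin 4)
    (x : Coord) : ℝ :=
  ricci g j l x - (1 / 2) * ricciScalar g x * g x j l

/-- The Weyl tensor in dimension four. -/
noncomputable def weyl (g : Coord → Matrix (Fin 4) (Fin 4) ℝ) (i j k l : Fin 4)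
    (x : Coord) : ℝ :=
  riemann g i j k l x
    - (1 / 2) * (g x i k * ricci g j l x - g x i l * ricci g j k x
        - g x j k * ricci g i l x + g x j l * ricci g i k x)
    + (1 / 6) * ricciScalar g x * (g x i k * g x j l - g x i l * g x j k)

/-- The volume form `ε_{ijkl} = √|det g| [ijkl]`; the Levi-Civita symbol `[I 0, I 1, I 2, I 3]` is
the determinant of the matrix whose rows are the standard basis vectors numbered by `I`. -/
noncomputable def volumeForm (g : Coord → Matrix (Fin 4) (Fin 4) ℝ) (I : Fin 4 → Fin 4)
    (x : Coord) : ℝ :=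
  Real.sqrt |(g x).det| *
    Matrix.det (Matrix.of fun p q : Fin 4 => if I p = q then (1 : ℝ) else 0)

/-! ### Polynomial curvature invariants -/

/-- A complete contraction scheme: a number of factors `R_{abcd}`, a number of factors `ε_{abcd}`,
and a division of all their index slots into (ordered) pairs. -/
structure CompleteContraction where
  /-- the number of curvature factors -/
  numRiemann : ℕ
  /-- the number of volume form factors -/
  numVolume : ℕ
  /-- the pairs of index slots that are contracted with each other; each slot occurs once -/
  pairing : Fin (2 * (numRiemann + numVolume)) × Fin 2 ≃
    (Fin numRiemann × Fin 4) ⊕ (Fin numVolume × Fin 4)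

/-- The scalar obtained from the product `R ⋯ R ε ⋯ ε` by contracting each pair of index slots with
the inverse metric: the sum over all assignments `I` of index values to the slots. -/
noncomputable def CompleteContraction.value (c : CompleteContraction)
    (g : Coord → Matrix (Fin 4) (Fin 4) ℝ) (x : Coord) : ℝ :=
  ∑ I : (Fin c.numRiemann × Fin 4) ⊕ (Fin c.numVolume × Fin 4) → Fin 4,
    (∏ p, riemann g (I (.inl (p, 0))) (I (.inl (p, 1))) (I (.inl (p, 2))) (I (.inl (p, 3))) x)
      * (∏ q, volumeForm g (fun s => I (.inr (q, s))) x)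
      * ∏ e, (g x)⁻¹ (I (c.pairing (e, 0))) (I (c.pairing (e, 1)))

/-- A polynomial curvature invariant is a polynomial with constant real coefficients in complete
contractions of the curvature tensor, the metric and the volume form. -/
abbrev PolynomialInvariant : Type := MvPolynomial CompleteContraction ℝ

/-- The scalar function that a polynomial curvature invariant assigns to the metric `g`. -/
noncomputable def PolynomialInvariant.value (P : PolynomialInvariant)
    (g : Coord → Matrix (Fin 4) (Fin 4) ℝ) (x : Coord) : ℝ :=
  MvPolynomial.eval (fun c : CompleteContraction => c.value g x) P

/-! ### FRW spacetimes, in coordinates `x = (t, r, θ, φ)` -/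

/-- The coordinate domain over the set `D` of times. -/
def chart (k : ℝ) (D : Set ℝ) : Set Coord :=
  {x | x 0 ∈ D ∧ 0 < x 1 ∧ 0 < 1 - k * x 1 ^ 2 ∧ (0 < x 2 ∧ x 2 < Real.pi) ∧
    (0 < x 3 ∧ x 3 < 2 * Real.pi)}

/-- The FRW metric `-dt² + a(t)² (dr² / (1 - k r²) + r² (dθ² + sin² θ dφ²))`. -/
noncomputable def metric (k : ℝ) (a : ℝ → ℝ) (x : Coord) : Matrix (Fin 4) (Fin 4) ℝ :=
  Matrix.diagonal
    ![-1, a (x 0) ^ 2 / (1 - k * x 1 ^ 2), a (x 0) ^ 2 * x 1 ^ 2,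
      a (x 0) ^ 2 * (x 1 ^ 2 * Real.sin (x 2) ^ 2)]

/-- The comoving frame: `frame k a x b` is the vector `e_b`, where `e_t = ∂_t`,
`e_r = (√(1 - k r²) / a) ∂_r`, `e_θ = (1 / (a r)) ∂_θ`, `e_φ = (1 / (a r sin θ)) ∂_φ`. -/
noncomputable def frame (k : ℝ) (a : ℝ → ℝ) (x : Coord) (b : Fin 4) : Fin 4 → ℝ :=
  Pi.single b (![1, Real.sqrt (1 - k * x 1 ^ 2) / a (x 0), 1 / (a (x 0) * x 1),
    1 / (a (x 0) * x 1 * Real.sin (x 2))] b)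

/-- The component `T(e_b, e_c)` of a covariant two-tensor field `T` in the comoving frame. -/
noncomputable def frameComponent (k : ℝ) (a : ℝ → ℝ) (T : Fin 4 → Fin 4 → Coord → ℝ)
    (b c : Fin 4) (x : Coord) : ℝ :=
  ∑ i, ∑ j, T i j x * frame k a x b i * frame k a x c j

/-- The component `R_{b̂ĉ}` of the Ricci tensor of the FRW metric in the comoving frame. -/
noncomputable def ricciHat (k : ℝ) (a : ℝ → ℝ) (b c : Fin 4) (x : Coord) : ℝ :=
  frameComponent k a (ricci (metric k a)) b c x

/-- The component `G_{b̂ĉ}` of the Einstein tensor of the FRW metric in the comoving frame. -/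
noncomputable def einsteinHat (k : ℝ) (a : ℝ → ℝ) (b c : Fin 4) (x : Coord) : ℝ :=
  frameComponent k a (einstein (metric k a)) b c x

/-- The filter on spacetime "the time of `x ∈ chart k D` runs along the filter `l` on `ℝ`"; for
`l = 𝓝[D] t₀` this is the approach to the time `t₀` from within `D`. -/
def approach (k : ℝ) (D : Set ℝ) (l : Filter ℝ) : Filter Coord :=
  comap (fun x : Coord => x 0) l ⊓ 𝓟 (chart k D)

/-- The scalar `f` stays finite along the filter `F`: it is eventually bounded. -/
def StaysFinite (f : Coord → ℝ) (F : Filter Coord) : Prop :=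
  ∃ C : ℝ, ∀ᶠ x in F, |f x| ≤ C

/-- The scalar `f` has a finite limit along the filter `F`. -/
def HasFiniteLimit (f : Coord → ℝ) (F : Filter Coord) : Prop :=
  ∃ L : ℝ, Tendsto f F (𝓝 L)

end FRW

/-! The FRW curvature is that of two sectional curvatures: `A = ä / a` on planes containing the time
direction and `B = (ȧ² + k) / a²` on spatial planes (`riemannUp_metric`). The Ricci tensor is
therefore diagonal with eigenvalues `3A`, once, and `A + 2B`, three times. The tested components are
`-3A` and `3B`, so the theorem compares the finiteness of all invariants with that of `A` and `B`.

In an orthonormal frame every complete contraction becomes a fixed polynomial expression in `A` and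
`B` (`CompleteContraction.value_metric`). Hence each invariant is a continuous function of `(A, B)`,
and such functions preserve both boundedness and convergence.

For the converse, traces of powers of the Ricci tensor suffice. The trace of its square, `12 (A² +
AB + B²)`, is positive definite, so bounding it bounds `A` and `B`. Convergence needs more: the
first two traces are symmetric under exchanging `A` and `B`, so they allow oscillation between `(A,
B)` and `(B, A)`. The third trace breaks the symmetry: the cube of the traceless Ricci tensor has
trace `3 (A - B)³`, and the real cube root is continuous (`hasFiniteLimit_of_powerSums`). -/

namespace FRW

/-! ### Diagonal metric and Levi-Civita connection -/

/-- The `i`-th diagonal entry of the FRW metric. -/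
noncomputable def diagEntry (k : ℝ) (a : ℝ → ℝ) (i : Fin 4) (x : Coord) : ℝ :=
  (![-1, a (x 0) ^ 2 / (1 - k * x 1 ^ 2), a (x 0) ^ 2 * x 1 ^ 2,
      a (x 0) ^ 2 * (x 1 ^ 2 * Real.sin (x 2) ^ 2)] : Fin 4 → ℝ) i

lemma metric_apply (k : ℝ) (a : ℝ → ℝ) (x : Coord) (i j : Fin 4) :
    metric k a x i j = if i = j then diagEntry k a i x else 0 := by
  simp only [metric, diagEntry, Matrix.diagonal_apply]

/-- The logarithmic derivative of the `i`-th diagonal entry in the `j`-th direction; it depends on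
the `j`-th coordinate only. -/
noncomputable def logDiag (k : ℝ) (a : ℝ → ℝ) (i j : Fin 4) (x : Coord) : ℝ :=
  (!![0, 0, 0, 0;
    2 * deriv a (x 0) / a (x 0), 2 * k * x 1 / (1 - k * x 1 ^ 2), 0, 0;
    2 * deriv a (x 0) / a (x 0), 2 / x 1, 0, 0;
    2 * deriv a (x 0) / a (x 0), 2 / x 1, 2 * Real.cos (x 2) / Real.sin (x 2), 0] :
    Matrix (Fin 4) (Fin 4) ℝ) i j

/-- The derivative of `logDiag k a i j` in the `j`-th direction. -/
noncomputable def logDiagDeriv (k : ℝ) (a : ℝ → ℝ) (i j : Fin 4) (x : Coord) : ℝ :=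
  (!![0, 0, 0, 0;
    2 * (deriv (deriv a) (x 0) * a (x 0) - deriv a (x 0) ^ 2) / a (x 0) ^ 2,
      2 * k * (1 + k * x 1 ^ 2) / (1 - k * x 1 ^ 2) ^ 2, 0, 0;
    2 * (deriv (deriv a) (x 0) * a (x 0) - deriv a (x 0) ^ 2) / a (x 0) ^ 2, -2 / x 1 ^ 2, 0, 0;
    2 * (deriv (deriv a) (x 0) * a (x 0) - deriv a (x 0) ^ 2) / a (x 0) ^ 2, -2 / x 1 ^ 2,
      -2 / Real.sin (x 2) ^ 2, 0] : Matrix (Fin 4) (Fin 4) ℝ) i j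

/-- The Christoffel symbols in terms of logarithmic derivatives of the diagonal metric. -/
noncomputable def diagChristoffel (k : ℝ) (a : ℝ → ℝ) (i j l : Fin 4) (x : Coord) : ℝ :=
  (1 / 2) * ((if i = l then logDiag k a i j x else 0) + (if i = j then logDiag k a i l x else 0)
    - (if j = l then logDiag k a j i x * diagEntry k a j x / diagEntry k a i x else 0))

section Chart

variable {k : ℝ} {a : ℝ → ℝ} {D : Set ℝ} {x : Coord}

lemma isOpen_chart (k : ℝ) (hD : IsOpen D) : IsOpen (chart k D) := by
  have h (i : Fin 4) : Continuous fun x : Coord => x i := continuous_apply i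
  have hk : Continuous fun x : Coord => 1 - k * x 1 ^ 2 :=
    continuous_const.sub (continuous_const.mul ((h 1).pow 2))
  exact (hD.preimage (h 0)).and <| (isOpen_lt continuous_const (h 1)).and <|
    (isOpen_lt continuous_const hk).and <|
    ((isOpen_lt continuous_const (h 2)).and (isOpen_lt (h 2) continuous_const)).and
      ((isOpen_lt continuous_const (h 3)).and (isOpen_lt (h 3) continuous_const))

lemma eventually_update_mem_chart (hD : IsOpen D) (hx : x ∈ chart k D) (i : Fin 4) :
    ∀ᶠ s in 𝓝 (x i), Function.update x i s ∈ chart k D := by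
  have hc : Continuous fun s : ℝ => Function.update x i s := by fun_prop
  refine hc.continuousAt.eventually ?_
  simp only [Function.update_eq_self]
  exact (isOpen_chart k hD).mem_nhds hx

lemma sin_pos_of_mem_chart (hx : x ∈ chart k D) : 0 < Real.sin (x 2) :=
  Real.sin_pos_of_pos_of_lt_pi hx.2.2.2.1.1 hx.2.2.2.1.2

lemma diagEntry_ne_zero (ha_pos : ∀ t ∈ D, 0 < a t) (hx : x ∈ chart k D) (i : Fin 4) :
    diagEntry k a i x ≠ 0 := by
  have h0 := ha_pos _ hx.1
  have h1 := hx.2.1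
  have h2 := hx.2.2.1
  have h3 := sin_pos_of_mem_chart hx
  fin_cases i <;> simp [diagEntry] <;> grind

lemma inv_metric_apply (ha_pos : ∀ t ∈ D, 0 < a t) (hx : x ∈ chart k D) (i j : Fin 4) :
    (metric k a x)⁻¹ i j = if i = j then (diagEntry k a i x)⁻¹ else 0 := by
  have h : (metric k a x)⁻¹ = Matrix.diagonal fun i => (diagEntry k a i x)⁻¹ := by
    refine Matrix.inv_eq_right_inv ?_
    have : metric k a x = Matrix.diagonal fun i => diagEntry k a i x := by
      ext i j; rw [metric_apply, Matrix.diagonal_apply]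
    rw [this, Matrix.diagonal_mul_diagonal, ← Matrix.diagonal_one]
    congr 1
    ext i
    exact mul_inv_cancel₀ (diagEntry_ne_zero ha_pos hx i)
  rw [h, Matrix.diagonal_apply]

lemma hasDerivAt_scale (hD : IsOpen D) (ha : ContDiffOn ℝ 2 a D) (hx : x ∈ chart k D) :
    HasDerivAt a (deriv a (x 0)) (x 0) :=
  ((ha.differentiableOn (by norm_num)).differentiableAt (hD.mem_nhds hx.1)).hasDerivAt

lemma hasDerivAt_deriv_scale (hD : IsOpen D) (ha : ContDiffOn ℝ 2 a D) (hx : x ∈ chart k D) :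
    HasDerivAt (deriv a) (deriv (deriv a) (x 0)) (x 0) := by
  have h : ContDiffOn ℝ 1 (deriv a) D := ((contDiffOn_succ_iff_deriv_of_isOpen (n := 1) hD).1
    (by simpa [one_add_one_eq_two] using ha)).2.2
  exact ((h.differentiableOn (by norm_num)).differentiableAt (hD.mem_nhds hx.1)).hasDerivAt

lemma hasDerivAt_diagEntry (hD : IsOpen D) (ha : ContDiffOn ℝ 2 a D)
    (ha_pos : ∀ t ∈ D, 0 < a t) (hx : x ∈ chart k D) (i m : Fin 4) :
    HasDerivAt (fun s => diagEntry k a i (Function.update x m s))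
      (logDiag k a i m x * diagEntry k a i x) (x m) := by
  have h0 := (ha_pos _ hx.1).ne'
  have h1 := hx.2.1.ne'
  have h2 := hx.2.2.1.ne'
  have h3 := (sin_pos_of_mem_chart hx).ne'
  have da := hasDerivAt_scale hD ha hx
  have da2 := da.pow 2
  have dr : HasDerivAt (fun s : ℝ => s ^ 2) (2 * x 1) (x 1) := by
    simpa using hasDerivAt_pow 2 (x 1)
  have dk : HasDerivAt (fun s : ℝ => 1 - k * s ^ 2) (-(k * (2 * x 1))) (x 1) :=
    (dr.const_mul k).const_sub 1
  have ds := (Real.hasDerivAt_sin (x 2)).pow 2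
  fin_cases m <;> fin_cases i <;>
    simp only [diagEntry, logDiag, Function.update, Fin.reduceFinMk, Fin.zero_eta, Fin.isValue,
      Fin.mk_one, Matrix.cons_val, Matrix.of_apply, eq_rec_constant, dite_eq_ite, if_true,
      Fin.reduceEq, if_false, zero_mul, one_ne_zero, zero_ne_one] <;>
    first
    | exact hasDerivAt_const _ _
    | exact (da2.div_const _).congr_deriv (by simp; field_simp)
    | exact (da2.mul_const _).congr_deriv (by simp; field_simp)
    | exact ((hasDerivAt_const (x 1) (a (x 0) ^ 2)).div dk h2).congr_deriv (by field_simp; ring)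
    | exact (dr.const_mul _).congr_deriv (by field_simp)
    | exact ((dr.mul_const _).const_mul _).congr_deriv (by field_simp)
    | exact ((ds.const_mul _).const_mul _).congr_deriv (by simp; field_simp)

lemma hasDerivAt_logDiag (hD : IsOpen D) (ha : ContDiffOn ℝ 2 a D)
    (ha_pos : ∀ t ∈ D, 0 < a t) (hx : x ∈ chart k D) (i j m : Fin 4) :
    HasDerivAt (fun s => logDiag k a i j (Function.update x m s))
      (if j = m then logDiagDeriv k a i j x else 0) (x m) := by
  have h0 := (ha_pos _ hx.1).ne'
  have h1 := hx.2.1.ne'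
  have h2 := hx.2.2.1.ne'
  have h3 := (sin_pos_of_mem_chart hx).ne'
  have da := (((hasDerivAt_deriv_scale hD ha hx).const_mul 2).div (hasDerivAt_scale hD ha hx) h0)
  have dr : HasDerivAt (fun s : ℝ => s ^ 2) (2 * x 1) (x 1) := by
    simpa using hasDerivAt_pow 2 (x 1)
  have dk : HasDerivAt (fun s : ℝ => 1 - k * s ^ 2) (-(k * (2 * x 1))) (x 1) :=
    (dr.const_mul k).const_sub 1
  have d11 := ((hasDerivAt_id' (x 1)).const_mul (2 * k)).div dk h2
  have d1 := (hasDerivAt_const (x 1) (2 : ℝ)).div (hasDerivAt_id' (x 1)) h1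
  have d2 := ((Real.hasDerivAt_cos (x 2)).const_mul 2).div (Real.hasDerivAt_sin (x 2)) h3
  have hsc := Real.sin_sq_add_cos_sq (x 2)
  fin_cases m <;> fin_cases j <;> fin_cases i <;>
    simp only [logDiagDeriv, logDiag, Function.update, Fin.reduceFinMk, Fin.zero_eta, Fin.isValue,
      Fin.mk_one, Matrix.cons_val, Matrix.of_apply, eq_rec_constant, dite_eq_ite, if_true,
      Fin.reduceEq, if_false, one_ne_zero, zero_ne_one] <;>
    first
    | exact hasDerivAt_const _ _
    | exact da.congr_deriv (by field_simp)
    | exact d11.congr_deriv (by field_simp; ring)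
    | exact d1.congr_deriv (by field_simp; ring)
    | exact d2.congr_deriv (by field_simp; linarith)

/-- Closed formulas hold only on the chart; since it is open, they may still be differentiated
there. -/
lemma partialDeriv_congr {f f' : Coord → ℝ} (hD : IsOpen D) (hx : x ∈ chart k D)
    (h : ∀ y ∈ chart k D, f y = f' y) (i : Fin 4) : partialDeriv i f x = partialDeriv i f' x := by
  refine EventuallyEq.deriv_eq ?_
  filter_upwards [eventually_update_mem_chart hD hx i] with s hs using h _ hs

lemma partialDeriv_metric (hD : IsOpen D) (ha : ContDiffOn ℝ 2 a D)
    (ha_pos : ∀ t ∈ D, 0 < a t) (hx : x ∈ chart k D) (m i j : Fin 4) :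
    partialDeriv m (fun y => metric k a y i j) x =
      if i = j then logDiag k a i m x * diagEntry k a i x else 0 := by
  simp only [partialDeriv, metric_apply]
  split_ifs with h
  · exact (hasDerivAt_diagEntry hD ha ha_pos hx i m).deriv
  · exact deriv_const _ _

lemma christoffel_metric (hD : IsOpen D) (ha : ContDiffOn ℝ 2 a D)
    (ha_pos : ∀ t ∈ D, 0 < a t) (hx : x ∈ chart k D) (i j l : Fin 4) :
    christoffel (metric k a) i j l x = diagChristoffel k a i j l x := by
  have h := diagEntry_ne_zero ha_pos hx i
  simp only [christoffel, diagChristoffel, partialDeriv_metric hD ha ha_pos hx,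
    inv_metric_apply ha_pos hx, ite_mul, zero_mul, Finset.sum_ite_eq, Finset.mem_univ, if_true]
  split_ifs <;> field_simp <;> ring

/-- Since `logDiag k a i j` varies with coordinate `j` alone, its derivative appears only when `m`
is that direction. The last term comes from the ratio of two diagonal entries, whose logarithmic
derivative is the difference of theirs. -/
lemma partialDeriv_christoffel (hD : IsOpen D) (ha : ContDiffOn ℝ 2 a D)
    (ha_pos : ∀ t ∈ D, 0 < a t) (hx : x ∈ chart k D) (m i j l : Fin 4) :
    partialDeriv m (christoffel (metric k a) i j l) x =
      (1 / 2) * ((if i = l then (if j = m then logDiagDeriv k a i j x else 0) else 0)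
        + (if i = j then (if l = m then logDiagDeriv k a i l x else 0) else 0)
        - (if j = l then ((if i = m then logDiagDeriv k a j i x else 0)
          + logDiag k a j i x * (logDiag k a j m x - logDiag k a i m x))
            * diagEntry k a j x / diagEntry k a i x else 0)) := by
  rw [partialDeriv_congr hD hx fun y hy => christoffel_metric hD ha ha_pos hy i j l]
  have h := diagEntry_ne_zero ha_pos hx i
  have hL := fun i j => hasDerivAt_logDiag hD ha ha_pos hx i j m
  have hG := fun i => hasDerivAt_diagEntry hD ha ha_pos hx i m
  have hq := ((hL j i).mul (hG j)).div (hG i) (by simpa using h)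
  refine HasDerivAt.deriv (HasDerivAt.const_mul _ (HasDerivAt.sub (HasDerivAt.add ?_ ?_) ?_))
  · split_ifs with h1 h2
    · simpa [h2] using hL i j
    · simpa [h2] using hL i j
    · exact hasDerivAt_const _ _
  · split_ifs with h1 h2
    · simpa [h2] using hL i l
    · simpa [h2] using hL i l
    · exact hasDerivAt_const _ _
  · by_cases h1 : j = l
    · simp only [h1, if_true] at hq ⊢
      refine hq.congr_deriv ?_
      simp only [Function.update_eq_self, Pi.mul_apply]
      field_simp
      ring
    · simpa only [h1, if_false] using hasDerivAt_const _ _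

end Chart

/-! ### Curvature, Ricci and Weyl tensors -/

/-- The sectional curvature of the `i`-`j` coordinate plane of an FRW spacetime, where `A = ä / a`
and `B = (ȧ² + k) / a²`. -/
def sectional (A B : ℝ) (i j : Fin 4) : ℝ := if i = 0 ∨ j = 0 then A else B

/-- The acceleration term `ä / a`. -/
noncomputable def accel (a : ℝ → ℝ) (t : ℝ) : ℝ := deriv (deriv a) t / a t

/-- The energy term `(ȧ² + k) / a²`. -/
noncomputable def energy (k : ℝ) (a : ℝ → ℝ) (t : ℝ) : ℝ :=
  deriv a t ^ 2 / a t ^ 2 + k / a t ^ 2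

section Curvature

variable {k : ℝ} {a : ℝ → ℝ} {D : Set ℝ} {x : Coord}

set_option maxHeartbeats 4000000 in
lemma riemannUp_metric (hD : IsOpen D) (ha : ContDiffOn ℝ 2 a D)
    (ha_pos : ∀ t ∈ D, 0 < a t) (hx : x ∈ chart k D) (i j m n : Fin 4) :
    riemannUp (metric k a) i j m n x =
      sectional (accel a (x 0)) (energy k a (x 0)) i j * diagEntry k a j x *
        ((if i = m then 1 else 0) * (if j = n then 1 else 0)
          - (if i = n then 1 else 0) * (if j = m then 1 else 0)) := by
  have h0 := (ha_pos _ hx.1).ne'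
  have h1 := hx.2.1.ne'
  have h2 := hx.2.2.1.ne'
  have h3 := (sin_pos_of_mem_chart hx).ne'
  have hsc : Real.cos (x 2) ^ 2 = 1 - Real.sin (x 2) ^ 2 := by
    rw [← Real.sin_sq_add_cos_sq (x 2)]; ring
  have anti : ∀ m n, riemannUp (metric k a) i j m n x = -riemannUp (metric k a) i j n m x := by
    intro m n
    simp only [riemannUp, Fin.sum_univ_four]
    ring
  -- Antisymmetry in the last two indices leaves six pairs `(m, n)` for the explicit computation.
  wlog hmn : m < n generalizing m n
  · rcases eq_or_lt_of_le (not_lt.1 hmn) with h | h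
    · have := anti m m
      rw [h, sub_self, mul_zero]
      linarith
    · rw [anti, this n m h]
      ring
  clear anti
  have h2' : 1 - x 1 ^ 2 * k ≠ 0 := by rwa [mul_comm]
  simp only [riemannUp, partialDeriv_christoffel hD ha ha_pos hx, christoffel_metric hD ha ha_pos hx,
    diagChristoffel, Fin.sum_univ_four]
  fin_cases m <;> fin_cases n <;> first | exact absurd hmn (by decide) | skip
  all_goals
    clear hmn
    fin_cases i <;> fin_cases j <;>
      simp [logDiag, logDiagDeriv, diagEntry, sectional, accel, energy] <;>
      field_simp <;> (try simp only [hsc]) <;> ring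

lemma riemann_metric (hD : IsOpen D) (ha : ContDiffOn ℝ 2 a D)
    (ha_pos : ∀ t ∈ D, 0 < a t) (hx : x ∈ chart k D) (i j m n : Fin 4) :
    riemann (metric k a) i j m n x =
      sectional (accel a (x 0)) (energy k a (x 0)) i j *
        (metric k a x i m * metric k a x j n - metric k a x i n * metric k a x j m) := by
  simp only [riemann, riemannUp_metric hD ha ha_pos hx, metric_apply, ite_mul, zero_mul,
    Finset.sum_ite_eq, Finset.mem_univ, if_true]
  split_ifs <;> ring

/-- The eigenvalues of the Ricci tensor of an FRW spacetime. -/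
def ricciEigenvalue (A B : ℝ) (i : Fin 4) : ℝ := if i = 0 then 3 * A else A + 2 * B

lemma ricci_metric (hD : IsOpen D) (ha : ContDiffOn ℝ 2 a D)
    (ha_pos : ∀ t ∈ D, 0 < a t) (hx : x ∈ chart k D) (j n : Fin 4) :
    ricci (metric k a) j n x =
      ricciEigenvalue (accel a (x 0)) (energy k a (x 0)) j * metric k a x j n := by
  simp only [ricci, riemannUp_metric hD ha ha_pos hx, metric_apply, Fin.sum_univ_four]
  fin_cases j <;> fin_cases n <;> simp [sectional, ricciEigenvalue] <;> ring

lemma ricciScalar_metric (hD : IsOpen D) (ha : ContDiffOn ℝ 2 a D)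
    (ha_pos : ∀ t ∈ D, 0 < a t) (hx : x ∈ chart k D) :
    ricciScalar (metric k a) x = 6 * (accel a (x 0) + energy k a (x 0)) := by
  have h := diagEntry_ne_zero ha_pos hx
  simp only [ricciScalar, ricci_metric hD ha ha_pos hx, inv_metric_apply ha_pos hx, metric_apply,
    ite_mul, zero_mul, Finset.sum_ite_eq, Finset.mem_univ, if_true]
  have h' (i : Fin 4) (c : ℝ) : (diagEntry k a i x)⁻¹ * (c * diagEntry k a i x) = c := by
    have := h i
    field_simp
  simp only [h', Fin.sum_univ_four, ricciEigenvalue]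
  simp
  ring

lemma weyl_metric (hD : IsOpen D) (ha : ContDiffOn ℝ 2 a D)
    (ha_pos : ∀ t ∈ D, 0 < a t) (hx : x ∈ chart k D) (i j m n : Fin 4) :
    weyl (metric k a) i j m n x = 0 := by
  simp only [weyl, riemann_metric hD ha ha_pos hx, ricci_metric hD ha ha_pos hx,
    ricciScalar_metric hD ha ha_pos hx]
  -- Vanishing of the Weyl tensor amounts to each sectional curvature being the mean of two Ricci
  -- eigenvalues minus a sixth of the Ricci scalar. For `i = j` this may fail, but then the metric
  -- factor is zero.
  have hs : sectional (accel a (x 0)) (energy k a (x 0)) i j *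
        (metric k a x i m * metric k a x j n - metric k a x i n * metric k a x j m) =
      ((ricciEigenvalue (accel a (x 0)) (energy k a (x 0)) i +
        ricciEigenvalue (accel a (x 0)) (energy k a (x 0)) j) / 2
        - (accel a (x 0) + energy k a (x 0))) *
        (metric k a x i m * metric k a x j n - metric k a x i n * metric k a x j m) := by
    by_cases hij : i = j
    · subst hij; ring
    · congr 1
      by_cases hi : i = 0 <;> by_cases hj : j = 0 <;>
        simp [sectional, ricciEigenvalue, hi, hj] <;>
        first | (exact absurd (hi.trans hj.symm) hij) | ring
  rw [hs]
  ring

/-- The scale factors of the comoving frame. -/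
noncomputable def scaleFactor (k : ℝ) (a : ℝ → ℝ) (i : Fin 4) (x : Coord) : ℝ :=
  (![1, a (x 0) / Real.sqrt (1 - k * x 1 ^ 2), a (x 0) * x 1,
    a (x 0) * x 1 * Real.sin (x 2)] : Fin 4 → ℝ) i

/-- The Minkowski signature. -/
def signature (i : Fin 4) : ℝ := if i = 0 then -1 else 1

lemma scaleFactor_pos (ha_pos : ∀ t ∈ D, 0 < a t) (hx : x ∈ chart k D) (i : Fin 4) :
    0 < scaleFactor k a i x := by
  have h0 := ha_pos _ hx.1
  have h1 := hx.2.1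
  have h2 := Real.sqrt_pos.2 hx.2.2.1
  have h3 := sin_pos_of_mem_chart hx
  fin_cases i <;> simp [scaleFactor] <;> positivity

lemma diagEntry_eq (hx : x ∈ chart k D) (i : Fin 4) :
    diagEntry k a i x = signature i * scaleFactor k a i x ^ 2 := by
  have h2 := Real.sq_sqrt hx.2.2.1.le
  fin_cases i <;> simp [scaleFactor, diagEntry, signature, div_pow, h2] <;> ring

lemma frame_eq (k : ℝ) (a : ℝ → ℝ) (x : Coord) (b i : Fin 4) :
    frame k a x b i = if i = b then (scaleFactor k a b x)⁻¹ else 0 := by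
  rw [frame, Pi.single_apply]
  congr 1
  fin_cases b <;> simp [scaleFactor]

lemma frameComponent_eq (k : ℝ) (a : ℝ → ℝ) (T : Fin 4 → Fin 4 → Coord → ℝ) (b c : Fin 4)
    (x : Coord) : frameComponent k a T b c x =
      T b c x * (scaleFactor k a b x)⁻¹ * (scaleFactor k a c x)⁻¹ := by
  simp [frameComponent, frame_eq]

lemma frameComponent_metric (ha_pos : ∀ t ∈ D, 0 < a t) (hx : x ∈ chart k D) (b c : Fin 4) :
    frameComponent k a (fun i j y => metric k a y i j) b c x =
      if b = c then signature b else 0 := by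
  have h := (scaleFactor_pos ha_pos hx b).ne'
  rw [frameComponent_eq, metric_apply, diagEntry_eq hx]
  split_ifs with hbc
  · subst hbc; field_simp
  · simp

lemma ricciHat_eq (hD : IsOpen D) (ha : ContDiffOn ℝ 2 a D)
    (ha_pos : ∀ t ∈ D, 0 < a t) (hx : x ∈ chart k D) (b c : Fin 4) :
    ricciHat k a b c x = ricciEigenvalue (accel a (x 0)) (energy k a (x 0)) b *
      if b = c then signature b else 0 := by
  rw [← frameComponent_metric ha_pos hx, ricciHat, frameComponent_eq, frameComponent_eq,
    ricci_metric hD ha ha_pos hx]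
  ring

lemma ricciHat_zero_zero (hD : IsOpen D) (ha : ContDiffOn ℝ 2 a D)
    (ha_pos : ∀ t ∈ D, 0 < a t) (hx : x ∈ chart k D) :
    ricciHat k a 0 0 x = -3 * accel a (x 0) := by
  rw [ricciHat_eq hD ha ha_pos hx]
  simp [ricciEigenvalue, signature]

lemma einsteinHat_zero_zero (hD : IsOpen D) (ha : ContDiffOn ℝ 2 a D)
    (ha_pos : ∀ t ∈ D, 0 < a t) (hx : x ∈ chart k D) :
    einsteinHat k a 0 0 x = 3 * energy k a (x 0) := by
  simp [einsteinHat, frameComponent_eq, einstein, ricci_metric hD ha ha_pos hx,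
    ricciScalar_metric hD ha ha_pos hx, metric_apply, diagEntry, scaleFactor, ricciEigenvalue]
  ring

end Curvature

/-! ### Complete contractions in an orthonormal frame -/

/-- The components of the curvature tensor of an FRW spacetime in an orthonormal frame. -/
def frameRiemann (A B : ℝ) (i j m n : Fin 4) : ℝ :=
  sectional A B i j * ((if i = m then signature i else 0) * (if j = n then signature j else 0)
    - (if i = n then signature i else 0) * (if j = m then signature j else 0))

/-- The value of a complete contraction of the curvature tensor of an FRW spacetime, computed in an
orthonormal frame. -/
noncomputable def CompleteContraction.frameValue (c : CompleteContraction) (A B : ℝ) : ℝ :=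
  ∑ I : (Fin c.numRiemann × Fin 4) ⊕ (Fin c.numVolume × Fin 4) → Fin 4,
    (∏ p, frameRiemann A B (I (.inl (p, 0))) (I (.inl (p, 1))) (I (.inl (p, 2))) (I (.inl (p, 3))))
      * (∏ q, Matrix.det (Matrix.of fun s t : Fin 4 => if I (.inr (q, s)) = t then (1 : ℝ) else 0))
      * ∏ e, (if I (c.pairing (e, 0)) = I (c.pairing (e, 1)) then
          signature (I (c.pairing (e, 0))) else 0)

section Contraction
variable {k : ℝ} {a : ℝ → ℝ} {D : Set ℝ} {x : Coord}

lemma metric_apply_scaleFactor (hx : x ∈ chart k D) (i j : Fin 4) :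
    metric k a x i j = (if i = j then signature i else 0) *
      (scaleFactor k a i x * scaleFactor k a j x) := by
  rw [metric_apply, diagEntry_eq hx]
  split_ifs with h
  · subst h; ring
  · simp

lemma inv_metric_apply_scaleFactor (ha_pos : ∀ t ∈ D, 0 < a t) (hx : x ∈ chart k D)
    (i j : Fin 4) : (metric k a x)⁻¹ i j = (if i = j then signature i else 0) *
      (scaleFactor k a i x * scaleFactor k a j x)⁻¹ := by
  rw [inv_metric_apply ha_pos hx, diagEntry_eq hx]
  split_ifs with h
  · subst h
    rw [mul_inv, ← sq]
    congr 1
    unfold signature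
    split_ifs <;> norm_num
  · simp

lemma riemann_metric_scaleFactor (hD : IsOpen D) (ha : ContDiffOn ℝ 2 a D)
    (ha_pos : ∀ t ∈ D, 0 < a t) (hx : x ∈ chart k D) (i j m n : Fin 4) :
    riemann (metric k a) i j m n x =
      frameRiemann (accel a (x 0)) (energy k a (x 0)) i j m n *
        (scaleFactor k a i x * scaleFactor k a j x * scaleFactor k a m x
          * scaleFactor k a n x) := by
  rw [riemann_metric hD ha ha_pos hx, frameRiemann]
  simp only [metric_apply_scaleFactor hx]
  ring

/-- A repeated index would give two equal rows, so a nonzero Levi-Civita symbol forces `I` to be a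
permutation. -/
lemma prod_apply_eq_prod_of_det_ne_zero {I : Fin 4 → Fin 4}
    (hI : Matrix.det (Matrix.of fun p q : Fin 4 => if I p = q then (1 : ℝ) else 0) ≠ 0)
    (h : Fin 4 → ℝ) : ∏ s, h (I s) = ∏ s, h s := by
  have hinj : Function.Injective I := by
    intro p q hpq
    by_contra hne
    refine hI (Matrix.det_zero_of_row_eq hne ?_)
    ext s
    simp [hpq]
  exact (Equiv.ofBijective I (Finite.injective_iff_bijective.1 hinj)).prod_comp h

lemma volumeForm_metric (ha_pos : ∀ t ∈ D, 0 < a t) (hx : x ∈ chart k D) (I : Fin 4 → Fin 4) :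
    volumeForm (metric k a) I x =
      Matrix.det (Matrix.of fun p q : Fin 4 => if I p = q then (1 : ℝ) else 0) *
        ∏ s, scaleFactor k a (I s) x := by
  have hdet : (metric k a x).det = -(∏ s, scaleFactor k a s x) ^ 2 := by
    have : metric k a x = Matrix.diagonal fun i => diagEntry k a i x := by
      ext i j; rw [metric_apply, Matrix.diagonal_apply]
    rw [this, Matrix.det_diagonal]
    simp only [diagEntry_eq hx, Fin.prod_univ_four, signature]
    simp
    ring
  have hpos : 0 < ∏ s, scaleFactor k a s x := Finset.prod_pos fun s _ => scaleFactor_pos ha_pos hx s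
  rw [volumeForm, hdet, abs_neg, abs_of_nonneg (sq_nonneg _), Real.sqrt_sq hpos.le]
  by_cases hI : Matrix.det (Matrix.of fun p q : Fin 4 => if I p = q then (1 : ℝ) else 0) = 0
  · simp only [hI, mul_zero, zero_mul]
  · rw [prod_apply_eq_prod_of_det_ne_zero hI fun s => scaleFactor k a s x, mul_comm]

/-- The agreement holds term by term: passing to the frame multiplies each tensor component by one
scale factor per slot, and these cancel against the inverse metrics. -/
lemma CompleteContraction.value_metric (c : CompleteContraction) (hD : IsOpen D)
    (ha : ContDiffOn ℝ 2 a D) (ha_pos : ∀ t ∈ D, 0 < a t) (hx : x ∈ chart k D) :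
    c.value (metric k a) x = c.frameValue (accel a (x 0)) (energy k a (x 0)) := by
  refine Finset.sum_congr rfl fun I _ => ?_
  simp only [riemann_metric_scaleFactor hD ha ha_pos hx, volumeForm_metric ha_pos hx,
    inv_metric_apply_scaleFactor ha_pos hx, Finset.prod_mul_distrib]
  -- The pairing is a bijection onto all slots, so each scale factor meets its inverse exactly once.
  have hslots : (∏ e, (scaleFactor k a (I (c.pairing (e, 0))) x *
      scaleFactor k a (I (c.pairing (e, 1))) x)⁻¹) * ((∏ p, ∏ s, scaleFactor k a (I (.inl (p, s))) x)
        * ∏ q, ∏ s, scaleFactor k a (I (.inr (q, s))) x) = 1 := by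
    rw [← Fintype.prod_prod_type' fun p s => scaleFactor k a (I (.inl (p, s))) x,
      ← Fintype.prod_prod_type' fun p s => scaleFactor k a (I (.inr (p, s))) x,
      ← Fintype.prod_sum_type fun s => scaleFactor k a (I s) x,
      ← c.pairing.prod_comp, Fintype.prod_prod_type, ← Finset.prod_mul_distrib]
    refine Finset.prod_eq_one fun e _ => ?_
    rw [Fin.prod_univ_two]
    refine inv_mul_cancel₀ (mul_ne_zero ?_ ?_) <;> exact (scaleFactor_pos ha_pos hx _).ne'
  simp only [Fin.prod_univ_four, Finset.prod_mul_distrib] at hslots ⊢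
  linear_combination (exp := 1)
    (∏ p, frameRiemann (accel a (x 0)) (energy k a (x 0)) (I (.inl (p, 0))) (I (.inl (p, 1)))
        (I (.inl (p, 2))) (I (.inl (p, 3))))
      * (∏ q, Matrix.det (Matrix.of fun s t : Fin 4 => if I (.inr (q, s)) = t then (1 : ℝ) else 0))
      * (∏ e, (if I (c.pairing (e, 0)) = I (c.pairing (e, 1)) then
          signature (I (c.pairing (e, 0))) else 0)) * hslots

lemma CompleteContraction.continuous_frameValue (c : CompleteContraction) :
    Continuous fun z : ℝ × ℝ => c.frameValue z.1 z.2 := by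
  have h (i j m n : Fin 4) : Continuous fun z : ℝ × ℝ => frameRiemann z.1 z.2 i j m n := by
    refine Continuous.mul ?_ continuous_const
    unfold sectional
    split_ifs
    · exact continuous_fst
    · exact continuous_snd
  exact continuous_finsetSum _ fun I _ =>
    ((continuous_finsetProd _ fun p _ => h _ _ _ _).mul continuous_const).mul continuous_const

/-- The value of a polynomial curvature invariant of an FRW spacetime is a continuous function of
`ä / a` and `(ȧ² + k) / a²`. -/
lemma PolynomialInvariant.exists_continuous (P : PolynomialInvariant) :
    ∃ f : ℝ × ℝ → ℝ, Continuous f ∧ ∀ (k : ℝ) (a : ℝ → ℝ) (D : Set ℝ), IsOpen D →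
      ContDiffOn ℝ 2 a D → (∀ t ∈ D, 0 < a t) → ∀ x ∈ chart k D,
      P.value (metric k a) x = f (accel a (x 0), energy k a (x 0)) := by
  refine ⟨fun z => MvPolynomial.eval (fun c : CompleteContraction => c.frameValue z.1 z.2) P,
    (MvPolynomial.continuous_eval P).comp
      (continuous_pi fun c => c.continuous_frameValue), fun k a D hD ha ha_pos x hx => ?_⟩
  simp only [PolynomialInvariant.value, fun c : CompleteContraction =>
    c.value_metric hD ha ha_pos hx]

end Contraction

/-! ### Traces of powers of the Ricci tensor -/

/-- The pairing of index slots of `n` curvature factors that contracts each of them to a Ricci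
tensor and contracts the last index of the `p`-th Ricci tensor with the first index of the
`σ p`-th. -/
def ricciPairing {n : ℕ} (σ : Equiv.Perm (Fin n)) :
    (Fin n ⊕ Fin n) × Fin 2 ≃ (Fin n × Fin 4) ⊕ (Fin 0 × Fin 4) where
  toFun s := match s with
    | (.inl p, u) => .inl (p, ![0, 2] u)
    | (.inr p, u) => .inl (![(p, 3), (σ p, 1)] u)
  invFun s := match s with
    | .inl (p, u) => ![(.inl p, 0), (.inr (σ.symm p), 1), (.inl p, 1), (.inr p, 0)] u
    | .inr (q, _) => q.elim0
  left_inv := by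
    rintro ⟨p | p, u⟩ <;> fin_cases u <;> simp
  right_inv := by
    rintro (⟨p, u⟩ | ⟨q, _⟩)
    · fin_cases u <;> simp
    · exact q.elim0

/-- The complete contraction of a product of `n` Ricci tensors along the permutation `σ`. -/
def ricciContraction {n : ℕ} (σ : Equiv.Perm (Fin n)) : CompleteContraction where
  numRiemann := n
  numVolume := 0
  pairing := (((finCongr (by omega)).trans finSumFinEquiv.symm).prodCongr
    (Equiv.refl (Fin 2))).trans (ricciPairing σ)

/-- A sum over index assignments against weights on the diagonals of paired slots collapses to a
sum over assignments of indices to pairs. -/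
lemma sum_mul_prod_diagonal {E S ι R : Type*} [Fintype E] [Fintype S] [Fintype ι] [DecidableEq E]
    [DecidableEq S] [DecidableEq ι] [CommSemiring R] (e : E × Fin 2 ≃ S) (F : (S → ι) → R)
    (w : ι → R) :
    ∑ I : S → ι, F I * ∏ p, (if I (e (p, 0)) = I (e (p, 1)) then w (I (e (p, 0))) else 0) =
      ∑ K : E → ι, F (fun s => K (e.symm s).1) * ∏ p, w (K p) := by
  symm
  -- Assignments constant on every pair are exactly those pulled back from pairs; any other has a
  -- zero factor.
  refine Finset.sum_of_injOn (fun (K : E → ι) (s : S) => K (e.symm s).1) ?_ (by simp [Set.MapsTo])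
    ?_ ?_
  · intro K _ K' _ h
    ext p
    simpa using congrFun h (e (p, 0))
  · intro I _ hI
    by_cases h : ∀ p, I (e (p, 0)) = I (e (p, 1))
    · refine (hI ⟨fun p => I (e (p, 0)), by simp, ?_⟩).elim
      funext s
      obtain ⟨⟨p, u⟩, rfl⟩ := e.surjective s
      fin_cases u
      · simp
      · simpa using h p
    · push Not at h
      obtain ⟨p, hp⟩ := h
      rw [Finset.prod_eq_zero (Finset.mem_univ p) (if_neg hp), mul_zero]
  · intro K _
    simp

lemma frameRiemann_trace (A B : ℝ) (b c : Fin 4) :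
    ∑ s, signature s * frameRiemann A B s b s c =
      if b = c then ricciEigenvalue A B b * signature b else 0 := by
  simp only [Fin.sum_univ_four]
  fin_cases b <;> fin_cases c <;>
    simp [frameRiemann, sectional, ricciEigenvalue, signature] <;> ring

lemma signature_mul_self (i : Fin 4) : signature i * signature i = 1 := by
  unfold signature; split_ifs <;> norm_num

/-- Summing over the index inside each curvature factor leaves a diagonal Ricci tensor; its sign
cancels that of the inverse metric linking it to the next one. If `σ` is a single cycle, only
constant `c` contribute, and the sum is the trace of the `n`-th power of the Ricci tensor. -/
lemma frameValue_ricciContraction {n : ℕ} (σ : Equiv.Perm (Fin n)) (A B : ℝ) :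
    (ricciContraction σ).frameValue A B =
      ∑ c : Fin n → Fin 4, ∏ p, if c p = c (σ p) then ricciEigenvalue A B (c p) else 0 := by
  have key : (ricciContraction σ).frameValue A B = ∑ K : Fin n ⊕ Fin n → Fin 4,
      (∏ p, frameRiemann A B (K (.inl p)) (K (.inr (σ.symm p))) (K (.inl p)) (K (.inr p))) *
        ∏ e, signature (K e) := by
    have : IsEmpty (Fin (ricciContraction σ).numVolume) := inferInstanceAs (IsEmpty (Fin 0))
    rw [CompleteContraction.frameValue]
    simp only [Finset.univ_eq_empty (α := Fin (ricciContraction σ).numVolume), Finset.prod_empty,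
      mul_one]
    rw [sum_mul_prod_diagonal]
    refine Fintype.sum_equiv (Equiv.arrowCongr
      ((finCongr (show 2 * (n + 0) = n + n by omega)).trans finSumFinEquiv.symm)
      (Equiv.refl (Fin 4))) _ _ fun K => ?_
    rw [← Equiv.prod_comp ((finCongr (show 2 * (n + 0) = n + n by omega)).trans finSumFinEquiv.symm)]
    refine congrArg₂ (· * ·) rfl (Finset.prod_congr rfl fun p _ => ?_)
    exact congrArg (fun q => signature (K q)) (Equiv.symm_apply_apply
      ((finCongr (show 2 * (n + 0) = n + n by omega)).trans finSumFinEquiv.symm) p).symm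
  -- Here `s p` labels the pair inside the `p`-th curvature factor and `c p` the link from it to
  -- factor `σ p`. For fixed `c` the sum over `s` factorises.
  have split : ∀ c : Fin n → Fin 4,
      ∑ s : Fin n → Fin 4, (∏ p, frameRiemann A B (s p) (c (σ.symm p)) (s p) (c p)) *
        ((∏ p, signature (s p)) * ∏ p, signature (c p)) =
      ∏ p, if c p = c (σ p) then ricciEigenvalue A B (c p) else 0 := by
    intro c
    calc _ = (∑ s : Fin n → Fin 4, ∏ p, signature (s p) *
          frameRiemann A B (s p) (c (σ.symm p)) (s p) (c p)) * ∏ p, signature (c p) := by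
          rw [Finset.sum_mul]
          refine Finset.sum_congr rfl fun s _ => ?_
          rw [Finset.prod_mul_distrib]
          ring
      _ = ∏ p, if c (σ.symm p) = c p then ricciEigenvalue A B (c (σ.symm p)) else 0 := by
          rw [← Fintype.prod_sum fun p s => signature s *
            frameRiemann A B s (c (σ.symm p)) s (c p), ← Finset.prod_mul_distrib]
          refine Finset.prod_congr rfl fun p _ => ?_
          rw [frameRiemann_trace]
          split_ifs with h
          · rw [h, mul_assoc, signature_mul_self, mul_one]
          · rw [zero_mul]
      _ = _ := by
          rw [← Equiv.prod_comp σ]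
          simp
  rw [key, ← (Equiv.sumArrowEquivProdArrow (Fin n) (Fin n) (Fin 4)).symm.sum_comp,
    Fintype.sum_prod_type_right]
  simp only [← split, Fintype.prod_sum_type]
  rfl

lemma frameValue_ricciContraction_one (A B : ℝ) :
    (ricciContraction (1 : Equiv.Perm (Fin 1))).frameValue A B = 6 * (A + B) := by
  rw [frameValue_ricciContraction, ← (Equiv.funUnique (Fin 1) (Fin 4)).symm.sum_comp]
  simp [Fin.sum_univ_four, ricciEigenvalue]
  ring

lemma frameValue_ricciContraction_two (A B : ℝ) :
    (ricciContraction (finRotate 2)).frameValue A B = 12 * (A ^ 2 + A * B + B ^ 2) := by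
  rw [frameValue_ricciContraction, ← (finTwoArrowEquiv (Fin 4)).symm.sum_comp,
    Fintype.sum_prod_type]
  simp [Fin.sum_univ_four, ricciEigenvalue, Fin.prod_univ_two]
  ring

lemma frameValue_ricciContraction_three (A B : ℝ) :
    (ricciContraction (finRotate 3)).frameValue A B = 27 * A ^ 3 + 3 * (A + 2 * B) ^ 3 := by
  rw [frameValue_ricciContraction, ← (Fin.consEquiv fun _ : Fin 3 => Fin 4).sum_comp,
    Fintype.sum_prod_type]
  simp only [← (finTwoArrowEquiv (Fin 4)).symm.sum_comp, Fintype.sum_prod_type]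
  simp [Fin.sum_univ_four, ricciEigenvalue, Fin.prod_univ_three, Fin.consEquiv]
  ring

/-- Cubing is a strictly increasing bijection of the line, and the inverse of an order isomorphism
is continuous. -/
lemma exists_continuous_cubeRoot : ∃ f : ℝ → ℝ, Continuous f ∧ ∀ y, f (y ^ 3) = y := by
  have hodd : Odd 3 := by decide
  have hroot {y : ℝ} (hy : 0 ≤ y) : (y ^ (((3 : ℕ) : ℝ)⁻¹)) ^ 3 = y :=
    Real.rpow_inv_natCast_pow hy (by norm_num)
  have hsurj : Function.Surjective fun y : ℝ => y ^ 3 := by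
    intro y
    rcases le_total 0 y with hy | hy
    · exact ⟨_, hroot hy⟩
    · refine ⟨-((-y) ^ (((3 : ℕ) : ℝ)⁻¹)), ?_⟩
      simp only [hodd.neg_pow, hroot (neg_nonneg.2 hy), neg_neg]
  let e : ℝ ≃o ℝ := StrictMono.orderIsoOfSurjective (fun y : ℝ => y ^ 3) hodd.strictMono_pow hsurj
  exact ⟨e.symm, e.symm.continuous, fun y => e.symm_apply_apply y⟩

lemma PolynomialInvariant.value_X (c : CompleteContraction)
    (g : Coord → Matrix (Fin 4) (Fin 4) ℝ) :
    PolynomialInvariant.value (MvPolynomial.X c) g = c.value g := by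
  funext x
  simp [PolynomialInvariant.value]

/-! ### Boundedness and convergence along a filter -/

section Approach
variable {k : ℝ} {D : Set ℝ} {l : Filter ℝ} {f f' : Coord → ℝ}

lemma eventuallyEq_approach (h : ∀ x ∈ chart k D, f x = f' x) : f =ᶠ[approach k D l] f' :=
  mem_inf_of_right (mem_principal.2 h)

lemma staysFinite_congr {F : Filter Coord} (h : f =ᶠ[F] f') :
    StaysFinite f F ↔ StaysFinite f' F :=
  exists_congr fun _ => eventually_congr (h.mono fun x hx => by rw [hx])

lemma hasFiniteLimit_congr {F : Filter Coord} (h : f =ᶠ[F] f') :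
    HasFiniteLimit f F ↔ HasFiniteLimit f' F :=
  exists_congr fun _ => tendsto_congr' h

lemma staysFinite_const_mul {F : Filter Coord} {c : ℝ} (hc : c ≠ 0) :
    StaysFinite (fun x => c * f x) F ↔ StaysFinite f F := by
  constructor
  · rintro ⟨C, hC⟩
    refine ⟨C / |c|, hC.mono fun x hx => ?_⟩
    rw [le_div_iff₀ (abs_pos.2 hc), mul_comm, ← abs_mul]
    exact hx
  · rintro ⟨C, hC⟩
    refine ⟨|c| * C, hC.mono fun x hx => ?_⟩
    rw [abs_mul]
    gcongr

lemma hasFiniteLimit_const_mul {F : Filter Coord} {c : ℝ} (hc : c ≠ 0) :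
    HasFiniteLimit (fun x => c * f x) F ↔ HasFiniteLimit f F := by
  constructor
  · rintro ⟨L, hL⟩
    refine ⟨c⁻¹ * L, ?_⟩
    simpa [inv_mul_cancel_left₀ hc] using hL.const_mul c⁻¹
  · rintro ⟨L, hL⟩
    exact ⟨c * L, hL.const_mul c⟩

/-- Bounded pairs stay in a compact rectangle, on which `φ` is bounded. -/
lemma StaysFinite.comp_continuous {F : Filter Coord} {A B : Coord → ℝ} {φ : ℝ × ℝ → ℝ}
    (hφ : Continuous φ) (hA : StaysFinite A F) (hB : StaysFinite B F) :
    StaysFinite (fun x => φ (A x, B x)) F := by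
  obtain ⟨C, hC⟩ := hA
  obtain ⟨C', hC'⟩ := hB
  obtain ⟨M, hM⟩ := (isCompact_Icc.prod isCompact_Icc :
    IsCompact (Set.Icc (-C) C ×ˢ Set.Icc (-C') C')).exists_bound_of_continuousOn hφ.continuousOn
  refine ⟨M, ?_⟩
  filter_upwards [hC, hC'] with x h h'
  exact hM (A x, B x) ⟨abs_le.1 h, abs_le.1 h'⟩

lemma HasFiniteLimit.comp_continuous {F : Filter Coord} {A B : Coord → ℝ} {φ : ℝ × ℝ → ℝ}
    (hφ : Continuous φ) (hA : HasFiniteLimit A F) (hB : HasFiniteLimit B F) :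
    HasFiniteLimit (fun x => φ (A x, B x)) F := by
  obtain ⟨L, hL⟩ := hA
  obtain ⟨L', hL'⟩ := hB
  exact ⟨φ (L, L'), (hφ.tendsto _).comp (hL.prodMk_nhds hL')⟩

lemma staysFinite_of_quadratic {F : Filter Coord} {A B : Coord → ℝ}
    (h : StaysFinite (fun x => 12 * (A x ^ 2 + A x * B x + B x ^ 2)) F) :
    StaysFinite A F ∧ StaysFinite B F := by
  obtain ⟨C, hC⟩ := h
  constructor <;>
  -- The form equals `9A² + 3(A + 2B)²` and also `9B² + 3(2A + B)²`, so `9A²` and `9B²` are at most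
  -- `C`. The bound `C + 1` then follows from `2|y| ≤ y² + 1`, with no square root of `C`.
  · refine ⟨C + 1, hC.mono fun x hx => ?_⟩
    have := (abs_le.1 hx).2
    have h1 := sq_nonneg (A x + 2 * B x)
    have h2 := sq_nonneg (2 * A x + B x)
    rw [abs_le]
    constructor <;> nlinarith [sq_nonneg (A x - 1), sq_nonneg (A x + 1), sq_nonneg (B x - 1),
      sq_nonneg (B x + 1)]

lemma hasFiniteLimit_of_powerSums {F : Filter Coord} {A B : Coord → ℝ}
    (h1 : HasFiniteLimit (fun x => 6 * (A x + B x)) F)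
    (h2 : HasFiniteLimit (fun x => 12 * (A x ^ 2 + A x * B x + B x ^ 2)) F)
    (h3 : HasFiniteLimit (fun x => 27 * A x ^ 3 + 3 * (A x + 2 * B x) ^ 3) F) :
    HasFiniteLimit A F ∧ HasFiniteLimit B F := by
  obtain ⟨p, hp⟩ := h1
  obtain ⟨q, hq⟩ := h2
  obtain ⟨r, hr⟩ := h3
  obtain ⟨root, hroot, hroot_cube⟩ := exists_continuous_cubeRoot
  have hs : Tendsto (fun x => A x + B x) F (𝓝 (p / 6)) := by
    refine (hp.div_const 6).congr fun x => ?_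
    ring
  -- With mean eigenvalue `m = p / 4`, the traceless eigenvalues are `3(A - B)/2` once and `-(A -
  -- B)/2` three times. Their cubes sum to `3 (A - B)³`, while expanding about `m` gives `r - 3mq +
  -- 8m³`.
  have hd3 : Tendsto (fun x => (A x - B x) ^ 3) F
      (𝓝 ((r - 3 * (p / 4) * q + 8 * (p / 4) ^ 3) / 3)) := by
    refine (((hr.sub (((hp.div_const 4).const_mul 3).mul hq)).add
      (((hp.div_const 4).pow 3).const_mul 8)).div_const 3).congr fun x => ?_
    ring
  have hd : Tendsto (fun x => A x - B x) F (𝓝 (root _)) :=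
    ((hroot.tendsto _).comp hd3).congr fun x => hroot_cube _
  exact ⟨⟨_, ((hs.add hd).div_const 2).congr fun x => by ring⟩,
    ⟨_, ((hs.sub hd).div_const 2).congr fun x => by ring⟩⟩

end Approach

end FRW

/-! ### The main theorem -/

open FRW

theorem theorem1 (k : ℝ) (hk : k = -1 ∨ k = 0 ∨ k = 1) (D : Set ℝ) (hD : IsOpen D)
    (a : ℝ → ℝ) (ha : ContDiffOn ℝ 2 a D) (ha_pos : ∀ t ∈ D, 0 < a t)
    (l : Filter ℝ) [l.NeBot] (hl : D ∈ l) :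
    -- the comoving frame is orthonormal
    (∀ x ∈ FRW.chart k D, ∀ b c : Fin 4,
      FRW.frameComponent k a (fun i j y => FRW.metric k a y i j) b c x =
        if b = c then (if b = 0 then -1 else 1) else 0) ∧
    -- the Weyl tensor vanishes
    (∀ x ∈ FRW.chart k D, ∀ i j m n : Fin 4, FRW.weyl (FRW.metric k a) i j m n x = 0) ∧
    -- the Ricci tensor has at most two independent orthonormal components
    (∀ x ∈ FRW.chart k D,
      (∀ b c : Fin 4, b ≠ c → FRW.ricciHat k a b c x = 0) ∧
      FRW.ricciHat k a 1 1 x = FRW.ricciHat k a 2 2 x ∧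
      FRW.ricciHat k a 2 2 x = FRW.ricciHat k a 3 3 x) ∧
    -- the two components to be tested
    (∀ x ∈ FRW.chart k D,
      FRW.ricciHat k a 0 0 x = -3 * (deriv (deriv a) (x 0) / a (x 0)) ∧
      FRW.einsteinHat k a 0 0 x =
        3 * (deriv a (x 0) ^ 2 / a (x 0) ^ 2 + k / a (x 0) ^ 2)) ∧
    -- they decide the finiteness of all polynomial curvature invariants
    ((∀ P : FRW.PolynomialInvariant,
        FRW.StaysFinite (P.value (FRW.metric k a)) (FRW.approach k D l)) ↔
      (FRW.StaysFinite (FRW.ricciHat k a 0 0) (FRW.approach k D l) ∧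
        FRW.StaysFinite (FRW.einsteinHat k a 0 0) (FRW.approach k D l))) ∧
    -- the same with finiteness read as convergence to a finite limit
    ((∀ P : FRW.PolynomialInvariant,
        FRW.HasFiniteLimit (P.value (FRW.metric k a)) (FRW.approach k D l)) ↔
      (FRW.HasFiniteLimit (FRW.ricciHat k a 0 0) (FRW.approach k D l) ∧
        FRW.HasFiniteLimit (FRW.einsteinHat k a 0 0) (FRW.approach k D l))) := by
  have hRicci := eventuallyEq_approach (k := k) (D := D) (l := l) fun x hx =>
    ricciHat_zero_zero hD ha ha_pos hx
  have hEinstein := eventuallyEq_approach (k := k) (D := D) (l := l) fun x hx =>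
    einsteinHat_zero_zero hD ha ha_pos hx
  have hInv (c : CompleteContraction) := eventuallyEq_approach (k := k) (D := D) (l := l)
    fun x hx => c.value_metric hD ha ha_pos hx
  refine ⟨fun x hx b c => frameComponent_metric ha_pos hx b c,
    fun x hx => weyl_metric hD ha ha_pos hx, fun x hx => ⟨fun b c hbc => ?_, ?_, ?_⟩,
    fun x hx => ⟨ricciHat_zero_zero hD ha ha_pos hx, einsteinHat_zero_zero hD ha ha_pos hx⟩, ?_, ?_⟩
  · rw [ricciHat_eq hD ha ha_pos hx, if_neg hbc, mul_zero]
  · simp [ricciHat_eq hD ha ha_pos hx, ricciEigenvalue, signature]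
  · simp [ricciHat_eq hD ha ha_pos hx, ricciEigenvalue, signature]
  · rw [staysFinite_congr hRicci, staysFinite_congr hEinstein,
      staysFinite_const_mul (by norm_num), staysFinite_const_mul (by norm_num)]
    refine ⟨fun h => staysFinite_of_quadratic ?_, fun h P => ?_⟩
    · have := h (MvPolynomial.X (ricciContraction (finRotate 2)))
      rw [PolynomialInvariant.value_X, staysFinite_congr (hInv _)] at this
      simpa only [frameValue_ricciContraction_two] using this
    · obtain ⟨φ, hφ, hP⟩ := P.exists_continuous
      rw [staysFinite_congr (eventuallyEq_approach (hP k a D hD ha ha_pos))]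
      exact h.1.comp_continuous hφ h.2
  · rw [hasFiniteLimit_congr hRicci, hasFiniteLimit_congr hEinstein,
      hasFiniteLimit_const_mul (by norm_num), hasFiniteLimit_const_mul (by norm_num)]
    refine ⟨fun h => ?_, fun h P => ?_⟩
    · have h' (c : CompleteContraction) : HasFiniteLimit
          (fun x : Coord => c.frameValue (accel a (x 0)) (energy k a (x 0))) (approach k D l) := by
        rw [← hasFiniteLimit_congr (hInv c), ← PolynomialInvariant.value_X]
        exact h _
      have h1 := h' (ricciContraction (1 : Equiv.Perm (Fin 1)))
      have h2 := h' (ricciContraction (finRotate 2))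
      have h3 := h' (ricciContraction (finRotate 3))
      simp only [frameValue_ricciContraction_one, frameValue_ricciContraction_two,
        frameValue_ricciContraction_three] at h1 h2 h3
      exact hasFiniteLimit_of_powerSums h1 h2 h3
    · obtain ⟨φ, hφ, hP⟩ := P.exists_continuous
      rw [hasFiniteLimit_congr (eventuallyEq_approach (hP k a D hD ha ha_pos))]
      exact h.1.comp_continuous hφ h.2
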